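/- Let $r\ge 0$ be an integer and let $\Gamma$ be a multigraph without loops (multiple edges are allowed, and no finiteness is required). If $r$ is odd, assume moreover that every edge of $\Gamma$ is oriented, i.e. its two end vertices are ordered. A \emph{circuit} $w$ in such a graph consists of edges $w_1,\dots,w_k$ $(k\ge 1)$ and vertices $v_1,\dots,v_k,v_{k+1}=v_1$ such that $v_i,v_{i+1}$ are the two end vertices of $w_i$ for every $i$; edges and vertices may be repeated. Let $\Lambda^r(\Gamma)$ be the following ring with one generator $e_\alpha$ (of degree $r-1$) for each edge $\alpha$ of $\Gamma$: if $r$ is even, the exterior algebra over $\mathbb Z$ on the generators $e_\alpha$; if $r$ is odd, the commutative ring $\mathbb Z[e_\alpha]/(e_\alpha^2)$. Writing $w_i$ also for the generator $e_{w_i}$, the \emph{Arnold class} of a circuit $w$ is $$A(w)=\sum_{i=1}^{k}(-1)^i\,w_1\cdots\widehat{w_i}\cdots w_k\ \text{ if } r \text{ is even},\qquad A(w)=\sum_{i=1}^{k}\epsilon_i(w)\,w_1\cdots\widehat{w_i}\cdots w_k\ \text{ if } r \text{ is odd},$$ where $\epsilon_i(w)=1$ if the orientation of the edge $w_i$ goes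 from $v_i$ to $v_{i+1}$, and $\epsilon_i(w)=-1$ otherwise. Let $I^r(\Gamma)$ be the two-sided ideal of $\Lambda^r(\Gamma)$ generated by the Arnold classes of all circuits of $\Gamma$, and let $R^r(\Gamma)=\Lambda^r(\Gamma)/I^r(\Gamma)$. Let $\Gamma'$ be a subgraph of $\Gamma$ with the same vertex set, $V(\Gamma')=V(\Gamma)$, with the orientation inherited from $\Gamma$ if $r$ is odd. Then the ring homomorphism $i_*:R^r(\Gamma')\to R^r(\Gamma)$ induced by the inclusion, which sends $e_\alpha$ to $e_\alpha$ for every edge $\alpha$ of $\Gamma'$, is injective. -/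

import Mathlib

open scoped Graph

noncomputable section

namespace GraphRing

universe u v

variable {α : Type u} {β : Type v}

/-- The defining relations of `Λ^r` on a set `E` of generators of degree `r - 1`: graded
commutativity (the sign `(-1)^((r-1)(r-1))` equals `(-1)^(r+1)`), and squares of generators
vanish. -/
inductive LambdaRel (r : ℕ) (E : Type v) : FreeAlgebra ℤ E → FreeAlgebra ℤ E → Prop
  | comm (a b : E) : LambdaRel r E (FreeAlgebra.ι ℤ a * FreeAlgebra.ι ℤ b)
      ((-1) ^ (r + 1) * (FreeAlgebra.ι ℤ b * FreeAlgebra.ι ℤ a))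
  | sq (a : E) : LambdaRel r E (FreeAlgebra.ι ℤ a * FreeAlgebra.ι ℤ a) 0

/-- The algebra `Λ^r` over `ℤ` on a set `E` of generators of degree `r - 1`: the exterior algebra
on `E` if `r` is even, the commutative algebra `ℤ[e | e ∈ E] / (e² | e ∈ E)` if `r` is odd. -/
abbrev Lambda (r : ℕ) (E : Type v) : Type v := RingQuot (LambdaRel r E)

/-- The generator of `Λ^r` given by `a`. -/
def gen (r : ℕ) {E : Type v} (a : E) : Lambda r E :=
  RingQuot.mkRingHom (LambdaRel r E) (FreeAlgebra.ι ℤ a)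

theorem gen_comm (r : ℕ) {E : Type v} (a b : E) :
    gen r a * gen r b = (-1) ^ (r + 1) * (gen r b * gen r a) := by
  simpa [gen] using RingQuot.mkRingHom_rel (LambdaRel.comm (r := r) a b)

theorem gen_sq (r : ℕ) {E : Type v} (a : E) : gen r a * gen r a = 0 := by
  simpa [gen] using RingQuot.mkRingHom_rel (LambdaRel.sq (r := r) a)

/-- The ring map `Λ^r(E) → Λ^r(F)` induced by a map of generating sets. -/
def lambdaMap (r : ℕ) {E F : Type v} (f : E → F) : Lambda r E →+* Lambda r F :=
  RingQuot.lift ⟨(FreeAlgebra.lift ℤ fun a => gen r (f a)).toRingHom, by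
    intro x y h
    cases h with
    | comm a b => simpa using gen_comm r (f a) (f b)
    | sq a => simpa using gen_sq r (f a)⟩

@[simp] theorem lambdaMap_gen (r : ℕ) {E F : Type v} (f : E → F) (a : E) :
    lambdaMap r f (gen r a) = gen r (f a) := by
  unfold lambdaMap
  rw [gen, RingQuot.lift_mkRingHom_apply]
  simp

/-- An orientation of a multigraph: an ordering of the two ends of every edge. -/
structure Orientation (G : Graph α β) where
  /-- The first end of an edge. -/
  tail : E(G) → α
  /-- The second end of an edge. -/
  head : E(G) → α
  isLink : ∀ e : E(G), G.IsLink e (tail e) (head e)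

/-- The orientation of a subgraph obtained by restriction. -/
def Orientation.restrict {G H : Graph α β} (o : Orientation G) (h : H ≤ G) : Orientation H where
  tail e := o.tail (Set.inclusion h.edgeSet_mono e)
  head e := o.head (Set.inclusion h.edgeSet_mono e)
  isLink e := (h.isLink_iff e.2).2 (o.isLink (Set.inclusion h.edgeSet_mono e))

/-- A step along an edge of a multigraph, from one end of the edge to the other. -/
structure Step (G : Graph α β) where
  /-- The vertex where the step starts. -/
  src : α
  /-- The edge of the step. -/
  edge : E(G)
  /-- The vertex where the step arrives. -/
  tgt : α
  isLink : G.IsLink edge src tgt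

/-- The steps `(v₁, w₁, v₂), (v₂, w₂, v₃), …, (v_k, w_k, v₁)`, with `k ≥ 1`, form a circuit. Edges
and vertices may be repeated. -/
def IsCircuit {G : Graph α β} (w : List (Step G)) : Prop :=
  w.IsChain (fun s t => s.tgt = t.src) ∧
    ∃ h : w ≠ [], (w.getLast h).tgt = (w.head h).src

open Classical in
/-- The coefficient of `w₁ ⋯ ŵ_i ⋯ w_k` in the Arnold class of a circuit, where `s` is the `i`-th
step of the circuit: `(-1)^i` if `r` is even; if `r` is odd, `1` or `-1` according to whether the
edge is traversed along its orientation or against it. An orientation is given only for odd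
`r`. -/
def arnoldSign (r : ℕ) {G : Graph α β} (o : Odd r → Orientation G) (i : ℕ) (s : Step G) : ℤ :=
  if h : Odd r then (if (o h).tail s.edge = s.src then 1 else -1) else (-1) ^ i

/-- The Arnold class `A(w) = ∑ᵢ ± w₁ ⋯ ŵ_i ⋯ w_k` of a sequence `w` of steps. The positions in a
list are numbered from `0`, hence the `i + 1`. -/
def arnoldClass (r : ℕ) {G : Graph α β} (o : Odd r → Orientation G) (w : List (Step G)) :
    Lambda r E(G) :=
  ∑ i : Fin w.length,
    arnoldSign r o (i + 1) w[i] • ((w.eraseIdx i).map fun s => gen r s.edge).prod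

/-- The generalized Arnold ideal `I^r(Γ)`, generated by the Arnold classes of all circuits. -/
def arnoldIdeal (r : ℕ) (G : Graph α β) (o : Odd r → Orientation G) :
    TwoSidedIdeal (Lambda r E(G)) :=
  TwoSidedIdeal.span {x | ∃ w : List (Step G), IsCircuit w ∧ arnoldClass r o w = x}

/-- The quotient ring `R^r(Γ) = Λ^r(Γ) / I^r(Γ)`. -/
abbrev R (r : ℕ) (G : Graph α β) (o : Odd r → Orientation G) : Type v :=
  (arnoldIdeal r G o).ringCon.Quotient

/-- The inclusion of a subgraph, on steps. -/
def Step.incl {G H : Graph α β} (h : H ≤ G) (s : Step H) : Step G where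
  src := s.src
  edge := Set.inclusion h.edgeSet_mono s.edge
  tgt := s.tgt
  isLink := s.isLink.mono h

theorem isCircuit_incl {G H : Graph α β} (h : H ≤ G) {w : List (Step H)} (hw : IsCircuit w) :
    IsCircuit (w.map (Step.incl h)) := by
  obtain ⟨hc, hne, hcl⟩ := hw
  refine ⟨?_, by simpa using hne, ?_⟩
  · rw [List.isChain_map]
    exact hc
  · rw [List.getLast_map, List.head_map]
    exact hcl

theorem lambdaMap_arnoldClass (r : ℕ) {G H : Graph α β} (o : Odd r → Orientation G) (h : H ≤ G)
    (w : List (Step H)) :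
    lambdaMap r (Set.inclusion h.edgeSet_mono) (arnoldClass r (fun hr => (o hr).restrict h) w) =
      arnoldClass r o (w.map (Step.incl h)) := by
  unfold arnoldClass
  rw [map_sum]
  refine Fintype.sum_equiv (finCongr (by simp)) _ _ fun i => ?_
  rw [map_zsmul, map_list_prod, List.map_map]
  have hi : (w.map (Step.incl h))[(finCongr (by simp) i : Fin (w.map (Step.incl h)).length)] =
      Step.incl h w[i] := by simp
  have hs : arnoldSign r o (i + 1) (Step.incl h w[i]) =
      arnoldSign r (fun hr => (o hr).restrict h) (i + 1) w[i] := rfl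
  rw [hi, finCongr_apply_coe, hs]
  simp [List.eraseIdx_map, Function.comp_def, Step.incl]

theorem arnoldIdeal_le_ker (r : ℕ) {G H : Graph α β} (o : Odd r → Orientation G) (h : H ≤ G) :
    (arnoldIdeal r H fun hr => (o hr).restrict h).ringCon ≤
      RingCon.ker ((arnoldIdeal r G o).ringCon.mk'.comp
        (lambdaMap r (Set.inclusion h.edgeSet_mono))) := by
  have key : arnoldIdeal r H (fun hr => (o hr).restrict h) ≤
      TwoSidedIdeal.ker ((arnoldIdeal r G o).ringCon.mk'.comp
        (lambdaMap r (Set.inclusion h.edgeSet_mono))) := by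
    refine TwoSidedIdeal.span_le.2 ?_
    rintro _ ⟨w, hw, rfl⟩
    rw [SetLike.mem_coe, TwoSidedIdeal.mem_ker, RingHom.comp_apply, lambdaMap_arnoldClass,
      ← map_zero (arnoldIdeal r G o).ringCon.mk']
    exact (RingCon.eq _).2 ((TwoSidedIdeal.mem_iff _ _).1
      (TwoSidedIdeal.subset_span ⟨_, isCircuit_incl h hw, rfl⟩))
  exact TwoSidedIdeal.ringCon_le_iff.1 key

/-- The ring map `R^r(Γ') → R^r(Γ)` induced by the inclusion of a subgraph `Γ'` of `Γ`. -/
def inclusionMap (r : ℕ) {G H : Graph α β} (o : Odd r → Orientation G) (h : H ≤ G) :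
    R r H (fun hr => (o hr).restrict h) →+* R r G o :=
  (arnoldIdeal r H fun hr => (o hr).restrict h).ringCon.lift
    ((arnoldIdeal r G o).ringCon.mk'.comp (lambdaMap r (Set.inclusion h.edgeSet_mono)))
    (arnoldIdeal_le_ker r o h)

/-- The class in `R^r(Γ)` of the generator given by an edge of `Γ`. -/
def edgeClass (r : ℕ) (G : Graph α β) (o : Odd r → Orientation G) (e : E(G)) : R r G o :=
  (arnoldIdeal r G o).ringCon.mk' (gen r e)

theorem inclusionMap_edgeClass (r : ℕ) {G H : Graph α β} (o : Odd r → Orientation G) (h : H ≤ G)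
    (e : E(H)) :
    inclusionMap r o h (edgeClass r H (fun hr => (o hr).restrict h) e) =
      edgeClass r G o (Set.inclusion h.edgeSet_mono e) := by
  unfold inclusionMap edgeClass
  rw [RingCon.lift_mk', RingHom.comp_apply, lambdaMap_gen]

end GraphRing

end

/-!
Send an edge from `a` to `b` to the class `e_ab` in the cohomology ring of the configurations in
`ℝ^r` of points labelled by the vertices. The relation `e_ab e_bc + e_bc e_ca + e_ca e_ab = 0` there
shows inductively that `e_ab` times the Arnold class of a walk from `a` to `b` is the product of the
edges of the walk, up to sign, so the Arnold classes of circuits vanish. Conversely, the kernel of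
this map from `Λ^r(Γ)` is the Arnold ideal. Hence `R^r(Γ)` embeds in a ring which depends only on
the vertices; as `R^r(Γ')` embeds in the same way, compatibly, it embeds in `R^r(Γ)`.

To see that an element `a + b f` of the kernel is in the Arnold ideal, where `a` and `b` do not
involve the edge `f`, use induction on the number of edges. The residue along the diagonal that
belongs to `f` sends `e_ab` to a matrix whose diagonal entries are the restriction of `e_ab` to the
diagonal and whose upper right entry is the coefficient of `e_uv`, where `u` and `v` are the ends of
`f`. These matrices satisfy the Arnold relations again. If no other edge joins `u` and `v`, then the
residue of `a + b f` is the image of `b`, so `b` is in the Arnold ideal of the graph in which `f` is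
contracted; if another edge does, it becomes a loop, and this ideal is the whole ring. A circuit of
the contracted graph is cut at the contracted vertex into walks of `Γ`, each of which is closed or
is closed up by `f`; so `b` is also the residue of an element `c + b f` of the Arnold ideal of `Γ`,
and the induction hypothesis applies to `a - c`.
-/

noncomputable section

namespace GraphRing

universe u v w

/-! ### The algebra `Λ^r` -/

section Lambda

variable {r : ℕ} {E : Type v} {A : Type w} [Ring A]

/-- The sign `(-1)^(r+1)` by which two generators of degree `r - 1` commute. -/
def sgn (r : ℕ) : ℤ := (-1) ^ (r + 1)

@[simp] theorem sgn_mul_self (r : ℕ) : sgn r * sgn r = 1 := by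
  rw [sgn, ← mul_pow, neg_one_mul, neg_neg, one_pow]

@[simp] theorem sgn_smul_sgn_smul {M : Type*} [AddCommGroup M] (r : ℕ) (x : M) :
    sgn r • sgn r • x = x := by
  rw [smul_smul, sgn_mul_self, one_smul]

theorem sgn_pow_add_two_mul (r n k : ℕ) : sgn r ^ (n + 2 * k) = sgn r ^ n := by
  rw [pow_add, pow_mul, sq, sgn_mul_self, one_pow, mul_one]

/-- A family of elements of a ring which satisfies the relations of the generators of `Λ^r`. -/
structure IsLambdaFamily (r : ℕ) (g : E → A) : Prop where
  comm : ∀ a b, g a * g b = sgn r • (g b * g a)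
  sq : ∀ a, g a * g a = 0

theorem isLambdaFamily_gen (r : ℕ) (E : Type v) : IsLambdaFamily r (gen r : E → Lambda r E) where
  comm a b := by
    rw [gen_comm, zsmul_eq_mul, sgn]
    push_cast
    rfl
  sq := gen_sq r

/-- The universal property of `Λ^r`. -/
def lambdaLift {g : E → A} (hg : IsLambdaFamily r g) : Lambda r E →+* A :=
  RingQuot.lift ⟨(FreeAlgebra.lift ℤ g).toRingHom, by
    rintro _ _ (⟨a, b⟩ | a)
    · simpa [sgn] using hg.comm a b
    · simpa using hg.sq a⟩

@[simp] theorem lambdaLift_gen {g : E → A} (hg : IsLambdaFamily r g) (a : E) :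
    lambdaLift hg (gen r a) = g a :=
  (RingQuot.lift_mkRingHom_apply _ _ _).trans (by simp)

theorem closure_range_gen (r : ℕ) (E : Type v) :
    Subring.closure (Set.range (gen r : E → Lambda r E)) = ⊤ := by
  refine top_unique fun x _ => ?_
  obtain ⟨x, rfl⟩ := RingQuot.mkRingHom_surjective _ x
  induction x using FreeAlgebra.induction with
  | grade0 n =>
    rw [eq_intCast (algebraMap ℤ (FreeAlgebra ℤ E)) n, map_intCast]
    exact intCast_mem _ n
  | grade1 a => exact Subring.subset_closure ⟨a, rfl⟩
  | mul x y hx hy => rw [map_mul]; exact mul_mem (hx trivial) (hy trivial)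
  | add x y hx hy => rw [map_add]; exact add_mem (hx trivial) (hy trivial)

theorem lambda_hom_ext {f g : Lambda r E →+* A} (h : ∀ a, f (gen r a) = g (gen r a)) : f = g :=
  RingHom.eq_of_eqOn_set_dense (closure_range_gen r E) (Set.forall_mem_range.2 h)

/-- The subring generated by the part of a family which is indexed by `S`. For the generators of
`Λ^r(E)` this is `Λ^r(S)`. -/
def genSubring (g : E → A) (S : Set E) : Subring A := Subring.closure (g '' S)

variable {g : E → A} {S T : Set E}

theorem mem_genSubring {e : E} (he : e ∈ S) : g e ∈ genSubring g S :=
  Subring.subset_closure ⟨e, he, rfl⟩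

theorem genSubring_mono (h : S ⊆ T) : genSubring g S ≤ genSubring g T :=
  Subring.closure_mono (Set.image_mono h)

theorem exists_finite_mem_genSubring (x : Lambda r E) :
    ∃ S : Set E, S.Finite ∧ x ∈ genSubring (gen r) S := by
  have hx : x ∈ ⨆ S : Finset E, genSubring (gen r) (S : Set E) := by
    have : (⊤ : Subring (Lambda r E)) ≤ ⨆ S : Finset E, genSubring (gen r) (S : Set E) := by
      rw [← closure_range_gen, Subring.closure_le]
      rintro _ ⟨e, rfl⟩
      exact le_iSup (fun S : Finset E => genSubring (gen r) (S : Set E)) {e}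
        (mem_genSubring (by simp))
    exact this trivial
  obtain ⟨S, hS⟩ := (Subring.mem_iSup_of_directed
    (Monotone.directed_le fun _ _ h => genSubring_mono (Finset.coe_subset.2 h))).1 hx
  exact ⟨S, S.finite_toSet, hS⟩

theorem exists_eq_add_mul_of_mem_closure_insert {s : Set A} {f y : A} (hf : f * f = 0)
    (hs : ∀ x ∈ s, ∃ n : ℤ, f * x = n • (x * f)) (hy : y ∈ Subring.closure (insert f s)) :
    ∃ a ∈ Subring.closure s, ∃ b ∈ Subring.closure s, y = a + b * f := by
  rw [Subring.mem_closure_iff] at hy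
  induction hy using AddSubgroup.closure_induction with
  | mem y h =>
    induction h using Submonoid.closure_induction_right with
    | one => exact ⟨1, one_mem _, 0, zero_mem _, by simp⟩
    | mul_right y _ x hx ih =>
      obtain ⟨a, ha, b, hb, rfl⟩ := ih
      obtain rfl | hx := hx
      · exact ⟨0, zero_mem _, a, ha, by rw [add_mul, mul_assoc, hf, mul_zero, add_comm]⟩
      · obtain ⟨n, hn⟩ := hs x hx
        have hx := Subring.subset_closure hx
        refine ⟨a * x, mul_mem ha hx, n • (b * x), zsmul_mem (mul_mem hb hx) _, ?_⟩
        rw [add_mul, mul_assoc b, hn, mul_smul_comm, smul_mul_assoc, mul_assoc]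
  | zero => exact ⟨0, zero_mem _, 0, zero_mem _, by simp⟩
  | add y z _ _ hy hz =>
    obtain ⟨a, ha, b, hb, rfl⟩ := hy
    obtain ⟨c, hc, d, hd, rfl⟩ := hz
    exact ⟨a + c, add_mem ha hc, b + d, add_mem hb hd, by rw [add_mul, add_add_add_comm]⟩
  | neg y _ hy =>
    obtain ⟨a, ha, b, hb, rfl⟩ := hy
    exact ⟨-a, neg_mem ha, -b, neg_mem hb, by rw [neg_mul, neg_add]⟩

theorem IsLambdaFamily.exists_eq_add_mul (hg : IsLambdaFamily r g) {f : E} {y : A}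
    (hy : y ∈ genSubring g (insert f S)) :
    ∃ a ∈ genSubring g S, ∃ b ∈ genSubring g S, y = a + b * g f := by
  rw [genSubring, Set.image_insert_eq] at hy
  refine exists_eq_add_mul_of_mem_closure_insert (hg.sq f) ?_ hy
  rintro _ ⟨e, -, rfl⟩
  exact ⟨sgn r, hg.comm f e⟩

end Lambda

/-! ### The Arnold ring of a configuration space -/

section Conf

variable {r : ℕ} {γ : Type u} {A : Type w} [Ring A]

/-- A family indexed by the pairs of points of `γ` which satisfies the relations of the classes
`e_ab` in the cohomology of the space of configurations in `ℝ^r`, where `r ≥ 2`, of points labelled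
by `γ`. The family is extended to the diagonal by zero, so that it can be pulled back along any
map. -/
structure IsArnoldFamily (r : ℕ) (g : γ → γ → A) : Prop where
  comm : ∀ a b c d, g a b * g c d = sgn r • (g c d * g a b)
  swap : ∀ a b, g b a = -sgn r • g a b
  self : ∀ a, g a a = 0
  triangle : ∀ a b c, g a b * g b c = g a c * g b c + sgn r • (g a c * g a b)

theorem IsArnoldFamily.sq {g : γ → γ → A} (hg : IsArnoldFamily r g) (a b : γ) :
    g a b * g a b = 0 := by
  have h := hg.triangle a b a
  rw [hg.self, zero_mul, zero_mul, smul_zero, add_zero, hg.swap a b, mul_smul_comm, neg_smul,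
    neg_eq_zero] at h
  rw [← sgn_smul_sgn_smul r (g a b * g a b), h, smul_zero]

theorem IsArnoldFamily.isLambdaFamily {g : γ → γ → A} (hg : IsArnoldFamily r g) {E : Type*}
    (s t : E → γ) : IsLambdaFamily r fun e => g (s e) (t e) :=
  ⟨fun _ _ => hg.comm _ _ _ _, fun _ => hg.sq _ _⟩

/-- The relations of an Arnold family which do not hold in `Λ^r` already. -/
inductive ConfRel (r : ℕ) (γ : Type u) : Lambda r (γ × γ) → Lambda r (γ × γ) → Prop
  | swap (a b : γ) : ConfRel r γ (gen r (b, a)) (-sgn r • gen r (a, b))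
  | self (a : γ) : ConfRel r γ (gen r (a, a)) 0
  | triangle (a b c : γ) : ConfRel r γ (gen r (a, b) * gen r (b, c))
      (gen r (a, c) * gen r (b, c) + sgn r • (gen r (a, c) * gen r (a, b)))

/-- The Arnold ring, that is the ring with a universal Arnold family. For `r ≥ 2` and finite `γ` it
is the cohomology ring of the space of configurations in `ℝ^r` of points labelled by `γ`. -/
def Conf (r : ℕ) (γ : Type u) : Type u := RingQuot (ConfRel r γ)

instance : Ring (Conf r γ) := inferInstanceAs (Ring (RingQuot (ConfRel r γ)))

/-- The projection of `Λ^r` onto its quotient ring `Conf r γ`. -/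
def confMk (r : ℕ) (γ : Type u) : Lambda r (γ × γ) →+* Conf r γ := RingQuot.mkRingHom (ConfRel r γ)

theorem confMk_rel {x y : Lambda r (γ × γ)} (h : ConfRel r γ x y) : confMk r γ x = confMk r γ y :=
  RingQuot.mkRingHom_rel h

/-- The universal Arnold family. -/
def conf (r : ℕ) (a b : γ) : Conf r γ := confMk r γ (gen r (a, b))

theorem isArnoldFamily_conf (r : ℕ) (γ : Type u) :
    IsArnoldFamily r (conf r : γ → γ → Conf r γ) where
  comm a b c d := by
    rw [conf, conf, ← map_mul, ← map_mul, (isLambdaFamily_gen r _).comm, map_zsmul]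
  swap a b := by simpa only [conf, map_zsmul] using confMk_rel (ConfRel.swap (r := r) a b)
  self a := by simpa only [conf, map_zero] using confMk_rel (ConfRel.self (r := r) a)
  triangle a b c := by
    simpa only [conf, map_zsmul, map_add, map_mul] using
      confMk_rel (ConfRel.triangle (r := r) a b c)

/-- The universal property of the Arnold ring. -/
def confLift {g : γ → γ → A} (hg : IsArnoldFamily r g) : Conf r γ →+* A :=
  RingQuot.lift ⟨lambdaLift (hg.isLambdaFamily Prod.fst Prod.snd), by
    rintro _ _ (⟨a, b⟩ | a | ⟨a, b, c⟩)
    · simpa using hg.swap a b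
    · simpa using hg.self a
    · simpa using hg.triangle a b c⟩

@[simp] theorem confLift_conf {g : γ → γ → A} (hg : IsArnoldFamily r g) (a b : γ) :
    confLift hg (conf r a b) = g a b :=
  (RingQuot.lift_mkRingHom_apply _ _ _).trans (by simp)

theorem intCast_conf_injective (r : ℕ) (γ : Type u) :
    Function.Injective (Int.cast : ℤ → Conf r γ) := by
  have hzero : IsArnoldFamily r fun _ _ : γ => (0 : ℤ) := by constructor <;> simp
  exact Function.LeftInverse.injective (g := confLift hzero) fun n => map_intCast _ n

open Classical in
/-- The map which identifies the point `v` with the point `u`. -/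
def collapse (u v a : γ) : γ := if a = v then u else a

@[simp] theorem collapse_left (u v : γ) : collapse u v u = u := by
  simp [collapse]

@[simp] theorem collapse_right (u v : γ) : collapse u v v = u := by
  simp [collapse]

theorem eq_or_of_collapse_eq {u v a b : γ} (h : collapse u v a = collapse u v b) :
    a = b ∨ a = u ∧ b = v ∨ a = v ∧ b = u := by
  unfold collapse at h
  split_ifs at h <;> simp_all

theorem collapse_eq_of_ne {u v a b : γ} (h : collapse u v a = collapse u v b) (hab : a ≠ b) :
    collapse u v a = u := by
  obtain h | ⟨rfl, rfl⟩ | ⟨rfl, rfl⟩ := eq_or_of_collapse_eq h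
  · exact absurd h hab
  · exact collapse_left _ _
  · exact collapse_right _ _

open Classical in
/-- The residue of `e_ab` along the diagonal `u = v`: the coefficient of `e_uv` in `e_ab`. -/
def pairResidue (r : ℕ) (u v a b : γ) : ℤ :=
  if a = u ∧ b = v then 1 else if a = v ∧ b = u then -sgn r else 0

variable {u v : γ}

@[simp] theorem pairResidue_pair (r : ℕ) (u v : γ) : pairResidue r u v u v = 1 := by
  simp [pairResidue]

theorem pairResidue_eq_zero_or (r : ℕ) (u v a b : γ) :
    pairResidue r u v a b = 0 ∨ collapse u v a = collapse u v b := by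
  unfold pairResidue
  split_ifs with h h <;> simp [h]

theorem pairResidue_self (r : ℕ) (huv : u ≠ v) (a : γ) : pairResidue r u v a a = 0 := by
  grind [pairResidue]

theorem pairResidue_swap (r : ℕ) (huv : u ≠ v) (a b : γ) :
    pairResidue r u v b a = -sgn r * pairResidue r u v a b := by
  grind [pairResidue, sgn_mul_self]

/-- The matrix with diagonal entries `x` and `sgn r • x` and upper right entry `d`. The upper right
entry is a derivation up to signs: it maps `x * y` to `x * e + sgn r • d * y`. -/
def residueMatrix (r : ℕ) (x : A) (d : ℤ) : Matrix (Fin 2) (Fin 2) A :=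
  !![x, d • (1 : A); 0, sgn r • x]

theorem smul_upperTriangular (n : ℤ) (x y z : A) :
    n • !![x, y; 0, z] = !![n • x, n • y; 0, n • z] := by
  ext i j
  fin_cases i <;> fin_cases j <;> simp

theorem upperTriangular_add (x y z x' y' z' : A) :
    !![x, y; 0, z] + !![x', y'; 0, z'] = !![x + x', y + y'; 0, z + z'] := by
  ext i j
  fin_cases i <;> fin_cases j <;> simp

theorem residueMatrix_mul (r : ℕ) (x y : A) (d e : ℤ) :
    residueMatrix r x d * residueMatrix r y e = !![x * y, e • x + (sgn r * d) • y; 0, x * y] := by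
  simp only [residueMatrix, Matrix.mul_fin_two, mul_smul_comm, smul_mul_assoc, mul_one, one_mul,
    mul_zero, zero_mul, add_zero, zero_add, smul_zero, smul_smul, sgn_mul_self,
    one_smul]

theorem isArnoldFamily_residueMatrix (r : ℕ) (huv : u ≠ v) :
    IsArnoldFamily r fun a b => residueMatrix r (conf r (collapse u v a) (collapse u v b))
      (pairResidue r u v a b) where
  comm a b c d := by
    simp only [residueMatrix_mul, smul_upperTriangular, smul_add, smul_smul, ← mul_assoc,
      sgn_mul_self, one_mul, ← (isArnoldFamily_conf r γ).comm]
    rw [add_comm]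
  swap a b := by
    simp only [residueMatrix, smul_upperTriangular, smul_smul, pairResidue_swap r huv a b,
      (isArnoldFamily_conf r γ).swap (collapse u v a), mul_comm (sgn r)]
  self a := by
    ext i j
    fin_cases i <;> fin_cases j <;>
      simp [residueMatrix, pairResidue_self r huv, (isArnoldFamily_conf r γ).self]
  triangle a b c := by
    have hbc : pairResidue r u v b c • conf r (collapse u v a) (collapse u v b) =
        pairResidue r u v b c • conf r (collapse u v a) (collapse u v c) := by
      rcases pairResidue_eq_zero_or r u v b c with h | h <;> simp [h]
    have hab : pairResidue r u v a b • conf r (collapse u v b) (collapse u v c) =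
        pairResidue r u v a b • conf r (collapse u v a) (collapse u v c) := by
      rcases pairResidue_eq_zero_or r u v a b with h | h <;> simp [h]
    have hac : pairResidue r u v a c • conf r (collapse u v b) (collapse u v c) =
        -sgn r • pairResidue r u v a c • conf r (collapse u v a) (collapse u v b) := by
      rcases pairResidue_eq_zero_or r u v a c with h | h
      · simp [h]
      · rw [← h, (isArnoldFamily_conf r γ).swap (collapse u v a) (collapse u v b), smul_comm]
    simp only [residueMatrix_mul, smul_upperTriangular, upperTriangular_add,
      (isArnoldFamily_conf r γ).triangle, mul_smul, hab, hbc, hac, smul_add,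
      neg_smul, smul_neg, sgn_smul_sgn_smul]
    congr 4
    abel

/-- The ring map which records the residue along the diagonal `u = v` together with the restriction
to it. -/
def confResidue (r : ℕ) (huv : u ≠ v) : Conf r γ →+* Matrix (Fin 2) (Fin 2) (Conf r γ) :=
  confLift (isArnoldFamily_residueMatrix r huv)

end Conf

/-! ### Arnold classes -/

section ArnoldSum

variable {α : Type u} {β : Type v} {G : Graph α β} {A : Type w} [Ring A] {r : ℕ}
  {o : Odd r → Orientation G} {g : E(G) → A}

open Classical in
/-- The sign `ε(s)` of a step, which is `1` if `r` is even. -/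
def stepSign (r : ℕ) (o : Odd r → Orientation G) (s : Step G) : ℤ :=
  if h : Odd r then (if (o h).tail s.edge = s.src then 1 else -1) else 1

theorem stepSign_mul_self (s : Step G) : stepSign r o s * stepSign r o s = 1 := by
  unfold stepSign
  split_ifs <;> norm_num

theorem arnoldSign_eq (i : ℕ) (s : Step G) : arnoldSign r o i s = sgn r ^ i * stepSign r o s := by
  by_cases h : Odd r
  · simp [arnoldSign, stepSign, sgn, h, h.add_one.neg_one_pow]
  · simp [arnoldSign, stepSign, sgn, h, (Nat.not_odd_iff_even.1 h).add_one.neg_one_pow]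

/-- The product `w₁ ⋯ w_k` of the edges of a sequence of steps. -/
def monomial (g : E(G) → A) (w : List (Step G)) : A := (w.map fun s => g s.edge).prod

/-- The Arnold class `∑ᵢ ± w₁ ⋯ ŵ_i ⋯ w_k` in an arbitrary ring with a family indexed by the edges.
The class `arnoldClass r o w` is the case of the generators of `Λ^r`. -/
def arnoldSum (r : ℕ) (o : Odd r → Orientation G) (g : E(G) → A) (w : List (Step G)) : A :=
  ∑ i : Fin w.length, arnoldSign r o (i + 1) w[i] • monomial g (w.eraseIdx i)

theorem arnoldClass_eq_arnoldSum (w : List (Step G)) :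
    arnoldClass r o w = arnoldSum r o (gen r) w := rfl

@[simp] theorem monomial_nil : monomial g [] = 1 := rfl

@[simp] theorem monomial_cons (s : Step G) (w : List (Step G)) :
    monomial g (s :: w) = g s.edge * monomial g w := List.prod_cons

theorem monomial_append (w w' : List (Step G)) :
    monomial g (w ++ w') = monomial g w * monomial g w' := by
  rw [monomial, List.map_append, List.prod_append, monomial, monomial]

theorem map_arnoldSum {B : Type*} [Ring B] (f : A →+* B) (w : List (Step G)) :
    f (arnoldSum r o g w) = arnoldSum r o (f ∘ g) w := by
  simp only [arnoldSum, monomial, map_sum, map_zsmul, map_list_prod, List.map_map]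
  rfl

@[simp] theorem arnoldSum_nil : arnoldSum r o g [] = 0 := rfl

theorem arnoldSum_cons (s : Step G) (w : List (Step G)) :
    arnoldSum r o g (s :: w) =
      (sgn r * stepSign r o s) • monomial g w + sgn r • (g s.edge * arnoldSum r o g w) := by
  simp only [arnoldSum, arnoldSign_eq, List.length_cons, Fin.sum_univ_succ, Finset.mul_sum,
    Finset.smul_sum, mul_smul_comm, smul_smul, ← mul_assoc, ← pow_succ']
  simp

theorem arnoldSum_singleton (s : Step G) :
    arnoldSum r o g [s] = (sgn r * stepSign r o s) • (1 : A) := by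
  simp [arnoldSum_cons]

theorem arnoldSum_append (w w' : List (Step G)) :
    arnoldSum r o g (w ++ w') = arnoldSum r o g w * monomial g w' +
      sgn r ^ w.length • (monomial g w * arnoldSum r o g w') := by
  induction w with
  | nil => simp
  | cons s w ih =>
    rw [List.cons_append, arnoldSum_cons, arnoldSum_cons, ih, monomial_append, monomial_cons,
      List.length_cons, pow_succ', mul_add, smul_add, add_mul, smul_mul_assoc, smul_mul_assoc,
      mul_smul_comm, smul_smul, add_assoc, mul_assoc, mul_assoc]

theorem monomial_mul_comm (hg : IsLambdaFamily r g) (w : List (Step G)) (e : E(G)) :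
    monomial g w * g e = sgn r ^ w.length • (g e * monomial g w) := by
  induction w with
  | nil => simp
  | cons s w ih =>
    rw [monomial_cons, mul_assoc, ih, mul_smul_comm, ← mul_assoc, hg.comm, smul_mul_assoc,
      smul_smul, List.length_cons, pow_succ, mul_assoc]

theorem arnoldSum_mul_comm (hg : IsLambdaFamily r g) (w : List (Step G)) (e : E(G)) :
    arnoldSum r o g w * g e = sgn r ^ (w.length + 1) • (g e * arnoldSum r o g w) := by
  induction w with
  | nil => simp
  | cons s w ih =>
    have h : g s.edge * arnoldSum r o g w * g e =
        sgn r ^ (w.length + 2) • (g e * (g s.edge * arnoldSum r o g w)) := by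
      rw [mul_assoc, ih, mul_smul_comm, ← mul_assoc, hg.comm, smul_mul_assoc, smul_smul, ← pow_succ,
        mul_assoc]
    rw [arnoldSum_cons, add_mul, smul_mul_assoc, smul_mul_assoc, monomial_mul_comm hg, h, mul_add,
      smul_add, mul_smul_comm, mul_smul_comm, List.length_cons,
      ← sgn_pow_add_two_mul r w.length 1, smul_comm _ (sgn r ^ _), smul_comm (sgn r) (sgn r ^ _)]

theorem arnoldSum_mul_monomial (hg : IsLambdaFamily r g) (w w' : List (Step G)) :
    arnoldSum r o g w * monomial g w' =
      sgn r ^ ((w.length + 1) * w'.length) • (monomial g w' * arnoldSum r o g w) := by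
  induction w' with
  | nil => simp
  | cons s w' ih =>
    rw [monomial_cons, ← mul_assoc, arnoldSum_mul_comm hg, smul_mul_assoc, mul_assoc, ih,
      mul_smul_comm, smul_smul, ← pow_add, mul_assoc, List.length_cons, mul_add_one, add_comm]

theorem arnoldSum_append_comm (hg : IsLambdaFamily r g) (w w' : List (Step G)) :
    arnoldSum r o g (w ++ w') = sgn r ^ (w.length * w'.length) • arnoldSum r o g (w' ++ w) := by
  have h : w.length * w'.length + (w'.length + 1) * w.length =
      w.length + 2 * (w.length * w'.length) := by ring
  rw [arnoldSum_append, arnoldSum_append, arnoldSum_mul_monomial hg w,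
    arnoldSum_mul_monomial hg w' w, smul_add, add_comm, smul_smul, smul_smul, ← pow_add,
    ← pow_add, h, sgn_pow_add_two_mul, add_one_mul]

variable {S : Set E(G)}

theorem monomial_mem {w : List (Step G)} (hw : ∀ s ∈ w, s.edge ∈ S) :
    monomial g w ∈ genSubring g S := by
  refine list_prod_mem fun x hx => ?_
  obtain ⟨s, hs, rfl⟩ := List.mem_map.1 hx
  exact mem_genSubring (hw s hs)

theorem arnoldSum_mem {w : List (Step G)} (hw : ∀ s ∈ w, s.edge ∈ S) :
    arnoldSum r o g w ∈ genSubring g S :=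
  sum_mem fun _ _ => zsmul_mem (monomial_mem fun _ hs => hw _ (List.mem_of_mem_eraseIdx hs)) _

end ArnoldSum

/-! ### Circuits modulo an identification of vertices -/

section Walk

variable {α : Type u} {β : Type v} {γ : Type*} {G : Graph α β}

/-- The sequence of steps is a walk from `a` to `b` after the identification of vertices by `φ`. -/
def IsWalk (φ : α → γ) : γ → List (Step G) → γ → Prop
  | a, [], b => a = b
  | a, s :: w, b => φ s.src = a ∧ IsWalk φ (φ s.tgt) w b

theorem IsWalk.append {φ : α → γ} {a b c : γ} {w w' : List (Step G)} (h : IsWalk φ a w b)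
    (h' : IsWalk φ b w' c) : IsWalk φ a (w ++ w') c := by
  induction w generalizing a with
  | nil => cases h; exact h'
  | cons s w ih => exact ⟨h.1, ih h.2⟩

theorem isWalk_singleton {φ : α → γ} (s : Step G) : IsWalk φ (φ s.src) [s] (φ s.tgt) :=
  ⟨rfl, rfl⟩

theorem isWalk_id_iff {a b : α} {w : List (Step G)} (hw : w ≠ []) :
    IsWalk id a w b ↔ w.IsChain (fun s t => s.tgt = t.src) ∧
      (w.head hw).src = a ∧ (w.getLast hw).tgt = b := by
  induction w generalizing a with
  | nil => exact absurd rfl hw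
  | cons s w ih =>
    cases w with
    | nil => simp [IsWalk]
    | cons t w =>
      rw [IsWalk, ih (List.cons_ne_nil t w)]
      simp only [List.isChain_cons_cons, List.head_cons, id_eq, List.getLast_cons_cons]
      tauto

theorem isCircuit_iff {w : List (Step G)} : IsCircuit w ↔ w ≠ [] ∧ ∃ a, IsWalk id a w a := by
  constructor
  · rintro ⟨hc, hne, hcl⟩
    exact ⟨hne, _, (isWalk_id_iff hne).2 ⟨hc, rfl, hcl⟩⟩
  · rintro ⟨hne, a, h⟩
    obtain ⟨hc, hsrc, htgt⟩ := (isWalk_id_iff hne).1 h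
    exact ⟨hc, hne, htgt.trans hsrc.symm⟩

theorem IsWalk.lift_or_cut {φ : α → γ} {u v a b : γ} {w : List (Step G)}
    (h : IsWalk (collapse u v ∘ φ) a w b) (hw : w ≠ []) :
    (∃ a' b', collapse u v a' = a ∧ collapse u v b' = b ∧ IsWalk φ a' w b') ∨
      ∃ p q, p ≠ [] ∧ q ≠ [] ∧ w = p ++ q ∧
        IsWalk (collapse u v ∘ φ) a p u ∧ IsWalk (collapse u v ∘ φ) u q b := by
  induction w generalizing a with
  | nil => exact absurd rfl hw
  | cons s w ih =>
    obtain ⟨rfl, h⟩ := h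
    obtain rfl | hw := eq_or_ne w []
    · exact Or.inl ⟨_, _, rfl, h, isWalk_singleton s⟩
    obtain ⟨a', b', ha', hb', hlift⟩ | ⟨p, q, -, hq, rfl, hap, hqb⟩ := ih h hw
    · obtain rfl | hne := eq_or_ne a' (φ s.tgt)
      · exact Or.inl ⟨_, _, rfl, hb', rfl, hlift⟩
      · have hu : (collapse u v ∘ φ) s.tgt = u := ha'.symm.trans (collapse_eq_of_ne ha' hne)
        exact Or.inr ⟨[s], w, by simp, hw, rfl, ⟨rfl, hu⟩, by rwa [hu] at h⟩
    · exact Or.inr ⟨s :: p, q, by simp, hq, rfl, ⟨rfl, hap⟩, hqb⟩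

/-- The step along the same edge in the opposite direction. -/
def Step.reverse (s : Step G) : Step G := ⟨s.tgt, s.edge, s.src, s.isLink.symm⟩

end Walk

section CircuitIdeal

variable {α : Type u} {β : Type v} {γ : Type*} {G : Graph α β} {A : Type w} [Ring A] {r : ℕ}
  {o : Odd r → Orientation G} {g : E(G) → A} {φ : α → γ} {S T : Set E(G)}

/-- The left ideal of the ring generated by the edges in `S` which is generated by the Arnold
classes of the closed walks on these edges, where the vertices are identified by `φ`. -/
def circuitIdeal (r : ℕ) (o : Odd r → Orientation G) (g : E(G) → A) (φ : α → γ) (S : Set E(G)) :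
    AddSubgroup A :=
  AddSubgroup.closure {x | ∃ m ∈ genSubring g S, ∃ (w : List (Step G)) (a : γ),
    (∀ s ∈ w, s.edge ∈ S) ∧ IsWalk φ a w a ∧ m * arnoldSum r o g w = x}

theorem mul_arnoldSum_mem_circuitIdeal {m : A} (hm : m ∈ genSubring g S) {w : List (Step G)}
    (hw : ∀ s ∈ w, s.edge ∈ S) {a : γ} (h : IsWalk φ a w a) :
    m * arnoldSum r o g w ∈ circuitIdeal r o g φ S :=
  AddSubgroup.subset_closure ⟨m, hm, w, a, hw, h, rfl⟩

theorem circuitIdeal_mono (h : S ⊆ T) : circuitIdeal r o g φ S ≤ circuitIdeal r o g φ T := by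
  refine AddSubgroup.closure_mono ?_
  rintro _ ⟨m, hm, w, a, hw, hwalk, rfl⟩
  exact ⟨m, genSubring_mono h hm, w, a, fun s hs => h (hw s hs), hwalk, rfl⟩

theorem mul_mem_circuitIdeal {m x : A} (hm : m ∈ genSubring g S)
    (hx : x ∈ circuitIdeal r o g φ S) : m * x ∈ circuitIdeal r o g φ S := by
  suffices circuitIdeal r o g φ S ≤ (circuitIdeal r o g φ S).comap (AddMonoidHom.mulLeft m) from
    this hx
  refine (AddSubgroup.closure_le _).2 ?_
  rintro _ ⟨n, hn, w, a, hw, h, rfl⟩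
  simpa [mul_assoc] using mul_arnoldSum_mem_circuitIdeal (mul_mem hm hn) hw h

/-- The Arnold class of a loop is `± 1`. -/
theorem mem_circuitIdeal_of_loop {f : Step G} (hf : f.edge ∈ S) (h : φ f.src = φ f.tgt) {x : A}
    (hx : x ∈ genSubring g S) : x ∈ circuitIdeal r o g φ S := by
  have hunit : arnoldSum r o g [f] * arnoldSum r o g [f] = 1 := by
    rw [arnoldSum_singleton, smul_one_mul, smul_smul, mul_mul_mul_comm, sgn_mul_self,
      stepSign_mul_self, one_mul, one_smul]
  have hmem : arnoldSum r o g [f] ∈ genSubring g S := arnoldSum_mem (by simpa using hf)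
  have hx : x * arnoldSum r o g [f] * arnoldSum r o g [f] ∈ circuitIdeal r o g φ S :=
    mul_arnoldSum_mem_circuitIdeal (mul_mem hx hmem) (by simpa using hf) (a := φ f.src)
      ⟨rfl, h.symm⟩
  rwa [mul_assoc, hunit, mul_one] at hx

/-- The elements `z` such that `z * g f` lies in the circuit ideal on `insert f S` up to an element
which does not involve `f`; that is, the residues along `f` of the elements of this ideal. -/
def residueSubgroup (r : ℕ) (o : Odd r → Orientation G) (g : E(G) → A) (φ : α → γ) (S : Set E(G))
    (f : E(G)) : AddSubgroup A :=
  (circuitIdeal r o g φ (insert f S) ⊔ (genSubring g S).toAddSubgroup).comap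
    (AddMonoidHom.mulRight (g f))

theorem mem_residueSubgroup {f : E(G)} {z : A} : z ∈ residueSubgroup r o g φ S f ↔
    ∃ c ∈ genSubring g S, c + z * g f ∈ circuitIdeal r o g φ (insert f S) := by
  simp only [residueSubgroup, AddSubgroup.mem_comap, AddMonoidHom.coe_mulRight, AddSubgroup.mem_sup,
    Subring.mem_toAddSubgroup]
  constructor
  · rintro ⟨x, hx, c, hc, h⟩
    exact ⟨-c, neg_mem hc, by rwa [← h, add_comm x, neg_add_cancel_left]⟩
  · rintro ⟨c, hc, h⟩
    exact ⟨_, h, -c, neg_mem hc, by rw [add_comm, neg_add_cancel_left]⟩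

theorem mul_mem_residueSubgroup {f : E(G)} {m z : A} (hm : m ∈ genSubring g S)
    (hz : z ∈ residueSubgroup r o g φ S f) : m * z ∈ residueSubgroup r o g φ S f := by
  obtain ⟨c, hc, h⟩ := mem_residueSubgroup.1 hz
  refine mem_residueSubgroup.2 ⟨m * c, mul_mem hm hc, ?_⟩
  rw [mul_assoc, ← mul_add]
  exact mul_mem_circuitIdeal (genSubring_mono (Set.subset_insert f S) hm) h

theorem arnoldSum_append_mem_residueSubgroup (hg : IsLambdaFamily r g) {f : E(G)}
    {w w' : List (Step G)} (hwS : ∀ s ∈ w, s.edge ∈ S) (hwS' : ∀ s ∈ w', s.edge ∈ S)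
    (hw : arnoldSum r o g w ∈ residueSubgroup r o g φ S f)
    (hw' : arnoldSum r o g w' ∈ residueSubgroup r o g φ S f) :
    arnoldSum r o g (w ++ w') ∈ residueSubgroup r o g φ S f := by
  rw [arnoldSum_append, arnoldSum_mul_monomial hg]
  exact add_mem (zsmul_mem (mul_mem_residueSubgroup (monomial_mem hwS') hw) _)
    (zsmul_mem (mul_mem_residueSubgroup (monomial_mem hwS) hw') _)

theorem arnoldSum_mem_residueSubgroup_of_isWalk_concat {f : Step G} {a : γ} {w : List (Step G)}
    (hwS : ∀ s ∈ w, s.edge ∈ S) (hw : IsWalk φ a (w ++ [f]) a) :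
    arnoldSum r o g w ∈ residueSubgroup r o g φ S f.edge := by
  have hc : arnoldSum r o g [f] ∈ genSubring g S := by
    rw [arnoldSum_singleton]
    exact zsmul_mem (one_mem _) _
  have hwf : ∀ s ∈ w ++ [f], s.edge ∈ insert f.edge S := by
    simpa [or_imp, forall_and] using fun s hs => Or.inr (hwS s hs)
  have h := mul_arnoldSum_mem_circuitIdeal (r := r) (o := o) (g := g) (one_mem _) hwf hw
  rw [one_mul, arnoldSum_append, monomial_cons, monomial_nil, mul_one, add_comm] at h
  exact mem_residueSubgroup.2 ⟨_, zsmul_mem (mul_mem (monomial_mem hwS) hc) _, h⟩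

theorem arnoldSum_mem_residueSubgroup_of_isWalk (hg : IsLambdaFamily r g) (f : Step G) {a b : γ}
    {w : List (Step G)} (hwS : ∀ s ∈ w, s.edge ∈ S) (hw : IsWalk φ a w b)
    (hab : collapse (φ f.src) (φ f.tgt) a = collapse (φ f.src) (φ f.tgt) b) :
    arnoldSum r o g w ∈ residueSubgroup r o g φ S f.edge := by
  obtain rfl | ⟨rfl, rfl⟩ | ⟨rfl, rfl⟩ := eq_or_of_collapse_eq hab
  · refine mem_residueSubgroup.2 ⟨0, zero_mem _, ?_⟩
    rw [zero_add, arnoldSum_mul_comm hg]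
    exact zsmul_mem (mul_arnoldSum_mem_circuitIdeal (mem_genSubring (Set.mem_insert _ _))
      (fun s hs => Set.mem_insert_of_mem _ (hwS s hs)) hw) _
  · exact arnoldSum_mem_residueSubgroup_of_isWalk_concat (f := f.reverse) hwS
      (hw.append (isWalk_singleton f.reverse))
  · exact arnoldSum_mem_residueSubgroup_of_isWalk_concat hwS (hw.append (isWalk_singleton f))

theorem arnoldSum_mem_residueSubgroup_of_isWalk_collapse_src (hg : IsLambdaFamily r g)
    (f : Step G) {w : List (Step G)} (hwS : ∀ s ∈ w, s.edge ∈ S)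
    (hw : IsWalk (collapse (φ f.src) (φ f.tgt) ∘ φ) (φ f.src) w (φ f.src)) :
    arnoldSum r o g w ∈ residueSubgroup r o g φ S f.edge := by
  induction hn : w.length using Nat.strong_induction_on generalizing w with
  | h n ih =>
    subst hn
    obtain rfl | hne := eq_or_ne w []
    · exact zero_mem _
    obtain ⟨a, b, ha, hb, hlift⟩ | ⟨p, q, hp, hq, rfl, hup, hqu⟩ := hw.lift_or_cut hne
    · exact arnoldSum_mem_residueSubgroup_of_isWalk hg f hwS hlift (ha.trans hb.symm)
    · have hpS : ∀ s ∈ p, s.edge ∈ S := fun s hs => hwS s (List.mem_append_left q hs)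
      have hqS : ∀ s ∈ q, s.edge ∈ S := fun s hs => hwS s (List.mem_append_right p hs)
      exact arnoldSum_append_mem_residueSubgroup hg hpS hqS
        (ih p.length (by simp [List.length_pos_iff, hq]) hpS hup rfl)
        (ih q.length (by simp [List.length_pos_iff, hp]) hqS hqu rfl)

theorem arnoldSum_mem_residueSubgroup_of_isWalk_collapse (hg : IsLambdaFamily r g) (f : Step G)
    {a : γ} {w : List (Step G)} (hwS : ∀ s ∈ w, s.edge ∈ S)
    (hw : IsWalk (collapse (φ f.src) (φ f.tgt) ∘ φ) a w a) :
    arnoldSum r o g w ∈ residueSubgroup r o g φ S f.edge := by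
  obtain rfl | hne := eq_or_ne w []
  · exact zero_mem _
  obtain ⟨b, c, hb, hc, hlift⟩ | ⟨p, q, -, -, rfl, hap, hqa⟩ := hw.lift_or_cut hne
  · exact arnoldSum_mem_residueSubgroup_of_isWalk hg f hwS hlift (hb.trans hc.symm)
  · rw [arnoldSum_append_comm hg]
    exact zsmul_mem (arnoldSum_mem_residueSubgroup_of_isWalk_collapse_src hg f
      (fun s hs => hwS s (by simpa [or_comm] using hs)) (hqa.append hap)) _

theorem circuitIdeal_collapse_le_residueSubgroup (hg : IsLambdaFamily r g) (f : Step G) :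
    circuitIdeal r o g (collapse (φ f.src) (φ f.tgt) ∘ φ) S ≤
      residueSubgroup r o g φ S f.edge := by
  refine (AddSubgroup.closure_le _).2 ?_
  rintro _ ⟨m, hm, w, a, hwS, hw, rfl⟩
  exact mul_mem_residueSubgroup hm (arnoldSum_mem_residueSubgroup_of_isWalk_collapse hg f hwS hw)

end CircuitIdeal

/-! ### The map to the Arnold ring -/

section ToConf

variable {α : Type u} {β : Type v} {γ : Type*} {G : Graph α β} {r : ℕ}

theorem exists_orientation_eq_const (o : Odd r → Orientation G) :
    ∃ O : Orientation G, o = fun _ => O := by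
  by_cases hr : Odd r
  · exact ⟨o hr, rfl⟩
  · have hlink : ∀ e : E(G), ∃ a b, G.IsLink e a b := fun e => G.exists_isLink_of_mem_edgeSet e.2
    choose a b hab using hlink
    exact ⟨⟨a, b, hab⟩, funext fun h => absurd h hr⟩

/-- The step along an edge in the direction of its orientation. -/
def Orientation.step (O : Orientation G) (e : E(G)) : Step G := ⟨O.tail e, e, O.head e, O.isLink e⟩

theorem Step.eq_tail_head_or (O : Orientation G) (s : Step G) :
    O.tail s.edge = s.src ∧ O.head s.edge = s.tgt ∨
      O.tail s.edge = s.tgt ∧ O.head s.edge = s.src :=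
  (O.isLink s.edge).eq_and_eq_or_eq_and_eq s.isLink

variable {A : Type w} [Ring A] {o : Odd r → Orientation G} {h : γ → γ → A} {g : E(G) → A}
  {φ : α → γ}

theorem IsArnoldFamily.apply_tail_head_eq_stepSign_smul (hh : IsArnoldFamily r h)
    (O : Orientation G) (φ : α → γ) (s : Step G) :
    h (φ (O.tail s.edge)) (φ (O.head s.edge)) =
      stepSign r (fun _ => O) s • h (φ s.src) (φ s.tgt) := by
  obtain ⟨ht, hd⟩ | ⟨ht, hd⟩ := s.eq_tail_head_or O
  · simp [stepSign, ht, hd]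
  · rw [ht, hd, hh.swap (φ s.src) (φ s.tgt)]
    by_cases hr : Odd r
    · by_cases hs : s.tgt = s.src
      · simp [hs, hh.self]
      · simp [stepSign, ht, hs, hr, sgn, hr.add_one.neg_one_pow]
    · simp [stepSign, hr, sgn, (Nat.not_odd_iff_even.1 hr).add_one.neg_one_pow]

theorem IsWalk.monomial_eq_smul_mul_arnoldSum (hh : IsArnoldFamily r h)
    (hg : ∀ s : Step G, g s.edge = stepSign r o s • h (φ s.src) (φ s.tgt)) {a b : γ}
    {w : List (Step G)} (hw : IsWalk φ a w b) (hne : w ≠ []) :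
    monomial g w = sgn r • (h a b * arnoldSum r o g w) := by
  induction w generalizing a with
  | nil => exact absurd rfl hne
  | cons s w ih =>
    obtain ⟨rfl, hw⟩ := hw
    obtain rfl | hne := eq_or_ne w []
    · obtain rfl : φ s.tgt = b := hw
      rw [arnoldSum_singleton, mul_smul_comm, smul_smul, ← mul_assoc, sgn_mul_self, one_mul,
        monomial_cons, monomial_nil, mul_one, mul_one, hg]
    · rw [arnoldSum_cons, monomial_cons, ih hw hne, hg]
      simp only [mul_smul_comm, smul_mul_assoc, mul_add, smul_add, smul_smul, ← mul_assoc,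
        sgn_mul_self, one_mul, hh.triangle, add_mul]
      rw [mul_right_comm, sgn_mul_self, one_mul, mul_comm (sgn r)]

theorem IsWalk.arnoldSum_eq_zero (hh : IsArnoldFamily r h)
    (hg : ∀ s : Step G, g s.edge = stepSign r o s • h (φ s.src) (φ s.tgt)) {a : γ}
    {w : List (Step G)} (hw : IsWalk φ a w a) (hloop : ∀ s ∈ w, φ s.src ≠ φ s.tgt) :
    arnoldSum r o g w = 0 := by
  obtain _ | ⟨s, w⟩ := w
  · rfl
  obtain ⟨rfl, hw⟩ := hw
  have hne : w ≠ [] := by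
    rintro rfl
    exact hloop s List.mem_cons_self hw.symm
  rw [arnoldSum_cons, hw.monomial_eq_smul_mul_arnoldSum hh hg hne, hg,
    hh.swap (φ s.src) (φ s.tgt)]
  simp only [smul_smul, smul_mul_assoc, neg_smul, smul_neg, neg_mul]
  rw [neg_add_eq_zero]
  congr 1
  linear_combination stepSign r o s * sgn r * sgn_mul_self r

variable {O : Orientation G} {S : Set E(G)}

/-- The ring map which sends an edge from `a` to `b` to the class `e_ab` of its ends, after the
identification of vertices by `φ`. -/
def toConf (r : ℕ) (O : Orientation G) (φ : α → γ) : Lambda r E(G) →+* Conf r γ :=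
  lambdaLift ((isArnoldFamily_conf r γ).isLambdaFamily (φ ∘ O.tail) (φ ∘ O.head))

@[simp] theorem toConf_gen (r : ℕ) (O : Orientation G) (φ : α → γ) (e : E(G)) :
    toConf r O φ (gen r e) = conf r (φ (O.tail e)) (φ (O.head e)) :=
  lambdaLift_gen _ e

theorem toConf_gen_step (s : Step G) :
    toConf r O φ (gen r s.edge) = stepSign r (fun _ => O) s • conf r (φ s.src) (φ s.tgt) := by
  rw [toConf_gen, (isArnoldFamily_conf r γ).apply_tail_head_eq_stepSign_smul]

theorem toConf_arnoldSum_eq_zero {a : γ} {w : List (Step G)} (hw : IsWalk φ a w a)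
    (hloop : ∀ s ∈ w, φ s.src ≠ φ s.tgt) :
    toConf r O φ (arnoldSum r (fun _ => O) (gen r) w) = 0 := by
  rw [map_arnoldSum]
  exact hw.arnoldSum_eq_zero (isArnoldFamily_conf r γ) toConf_gen_step hloop

theorem toConf_eq_zero_of_mem_circuitIdeal (hS : ∀ e ∈ S, φ (O.tail e) ≠ φ (O.head e))
    {x : Lambda r E(G)} (hx : x ∈ circuitIdeal r (fun _ => O) (gen r) φ S) :
    toConf r O φ x = 0 := by
  suffices circuitIdeal r (fun _ => O) (gen r) φ S ≤ (toConf r O φ).toAddMonoidHom.ker from this hx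
  refine (AddSubgroup.closure_le _).2 ?_
  rintro _ ⟨m, -, w, a, hwS, hw, rfl⟩
  have hloop : ∀ s ∈ w, φ s.src ≠ φ s.tgt := by
    intro s hs
    have h := hS s.edge (hwS s hs)
    obtain ⟨ht, hh⟩ | ⟨ht, hh⟩ := s.eq_tail_head_or O
    · rwa [ht, hh] at h
    · rw [ht, hh] at h
      exact h.symm
  refine ((toConf r O φ).map_mul _ _).trans ?_
  rw [toConf_arnoldSum_eq_zero hw hloop, mul_zero]

theorem confResidue_toConf_gen {u v : γ} (huv : u ≠ v) (e : E(G)) :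
    confResidue r huv (toConf r O φ (gen r e)) =
      residueMatrix r (toConf r O (collapse u v ∘ φ) (gen r e))
        (pairResidue r u v (φ (O.tail e)) (φ (O.head e))) := by
  rw [toConf_gen, toConf_gen, confResidue, confLift_conf]
  rfl

theorem exists_confResidue_toConf_eq_diagonal {u v : γ} (huv : u ≠ v)
    (hS : ∀ e ∈ S, collapse u v (φ (O.tail e)) ≠ collapse u v (φ (O.head e)))
    {y : Lambda r E(G)} (hy : y ∈ genSubring (gen r) S) :
    ∃ z, confResidue r huv (toConf r O φ y) =
      !![toConf r O (collapse u v ∘ φ) y, 0; 0, z] := by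
  induction hy using Subring.closure_induction with
  | mem y h =>
    obtain ⟨e, he, rfl⟩ := h
    have hres : pairResidue r u v (φ (O.tail e)) (φ (O.head e)) = 0 :=
      (pairResidue_eq_zero_or ..).resolve_right (hS e he)
    exact ⟨_, by rw [confResidue_toConf_gen, hres, residueMatrix, zero_smul]⟩
  | zero => exact ⟨0, by rw [map_zero, map_zero, map_zero, Matrix.eta_fin_two 0]; rfl⟩
  | one => exact ⟨1, by simp [Matrix.one_fin_two]⟩
  | add x y _ _ hx hy =>
    obtain ⟨z, hx⟩ := hx
    obtain ⟨z', hy⟩ := hy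
    exact ⟨z + z', by rw [map_add, map_add, map_add, hx, hy, upperTriangular_add, add_zero]⟩
  | neg x _ hx =>
    obtain ⟨z, hx⟩ := hx
    exact ⟨-z, by rw [map_neg, map_neg, map_neg, hx]; simp⟩
  | mul x y _ _ hx hy =>
    obtain ⟨z, hx⟩ := hx
    obtain ⟨z', hy⟩ := hy
    exact ⟨z * z', by rw [map_mul, map_mul, map_mul, hx, hy]; simp⟩

theorem toConf_collapse_eq_zero {f : E(G)} (hf : φ (O.tail f) ≠ φ (O.head f))
    (hS : ∀ e ∈ S, collapse (φ (O.tail f)) (φ (O.head f)) (φ (O.tail e)) ≠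
      collapse (φ (O.tail f)) (φ (O.head f)) (φ (O.head e)))
    {a b : Lambda r E(G)} (ha : a ∈ genSubring (gen r) S) (hb : b ∈ genSubring (gen r) S)
    (h : toConf r O φ (a + b * gen r f) = 0) :
    toConf r O (collapse (φ (O.tail f)) (φ (O.head f)) ∘ φ) b = 0 := by
  obtain ⟨z, hz⟩ := exists_confResidue_toConf_eq_diagonal hf hS ha
  obtain ⟨z', hz'⟩ := exists_confResidue_toConf_eq_diagonal hf hS hb
  have hmatrix := congrArg (confResidue r hf) h
  rw [map_add, map_add, map_mul, map_mul, confResidue_toConf_gen, hz, hz', map_zero] at hmatrix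
  simpa [residueMatrix] using congrFun (congrFun hmatrix 0) 1

theorem mem_circuitIdeal_of_forall_ne_imp {x : Lambda r E(G)} (hx : x ∈ genSubring (gen r) S)
    (h : (∀ e ∈ S, φ (O.tail e) ≠ φ (O.head e)) →
      x ∈ circuitIdeal r (fun _ => O) (gen r) φ S) :
    x ∈ circuitIdeal r (fun _ => O) (gen r) φ S := by
  by_cases hloop : ∃ e ∈ S, φ (O.tail e) = φ (O.head e)
  · obtain ⟨e, he, hends⟩ := hloop
    exact mem_circuitIdeal_of_loop (f := O.step e) he hends hx
  · push Not at hloop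
    exact h hloop

theorem mem_circuitIdeal_of_toConf_eq_zero (hS : S.Finite) {y : Lambda r E(G)}
    (hy : y ∈ genSubring (gen r) S) (h : toConf r O φ y = 0) :
    y ∈ circuitIdeal r (fun _ => O) (gen r) φ S := by
  induction S, hS using Set.Finite.induction_on generalizing φ y with
  | empty =>
    rw [genSubring, Set.image_empty, Subring.closure_empty] at hy
    obtain ⟨n, rfl⟩ := Subring.mem_bot.1 hy
    rw [map_intCast] at h
    obtain rfl := intCast_conf_injective r γ (h.trans Int.cast_zero.symm)
    simp
  | @insert f S _ _ ih =>
    refine mem_circuitIdeal_of_forall_ne_imp hy fun hloop => ?_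
    obtain ⟨a, ha, b, hb, rfl⟩ := (isLambdaFamily_gen r E(G)).exists_eq_add_mul hy
    have hb_contracted : b ∈ circuitIdeal r (fun _ => O) (gen r)
        (collapse (φ (O.tail f)) (φ (O.head f)) ∘ φ) S :=
      mem_circuitIdeal_of_forall_ne_imp hb fun hloop' =>
        ih hb (toConf_collapse_eq_zero (hloop f (Set.mem_insert f S)) hloop' ha hb h)
    obtain ⟨c, hc, hcb⟩ := mem_residueSubgroup.1 <|
      circuitIdeal_collapse_le_residueSubgroup (isLambdaFamily_gen r E(G)) (O.step f) hb_contracted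
    have hac : toConf r O φ (a - c) = 0 := by
      have hcb_zero := toConf_eq_zero_of_mem_circuitIdeal hloop hcb
      rw [map_add] at h hcb_zero
      rw [map_sub, ← add_sub_add_right_eq_sub, h]
      exact sub_eq_zero.2 hcb_zero.symm
    have hsum := add_mem (circuitIdeal_mono (Set.subset_insert f S) (ih (sub_mem ha hc) hac)) hcb
    rwa [add_comm c, sub_add_add_cancel] at hsum

theorem mem_arnoldIdeal_of_mem_circuitIdeal (o : Odd r → Orientation G) {x : Lambda r E(G)}
    (hx : x ∈ circuitIdeal r o (gen r) id S) : x ∈ arnoldIdeal r G o := by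
  induction hx using AddSubgroup.closure_induction with
  | mem x h =>
    obtain ⟨m, -, w, a, -, hw, rfl⟩ := h
    obtain rfl | hne := eq_or_ne w []
    · exact TwoSidedIdeal.mul_mem_left _ _ _ (TwoSidedIdeal.zero_mem _)
    · exact TwoSidedIdeal.mul_mem_left _ _ _
        (TwoSidedIdeal.subset_span ⟨w, isCircuit_iff.2 ⟨hne, a, hw⟩, rfl⟩)
  | zero => exact TwoSidedIdeal.zero_mem _
  | add x y _ _ hx hy => exact TwoSidedIdeal.add_mem _ hx hy
  | neg x _ hx => exact TwoSidedIdeal.neg_mem _ hx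

theorem mem_arnoldIdeal_iff (hG : G.Loopless) (O : Orientation G) {x : Lambda r E(G)} :
    x ∈ arnoldIdeal r G (fun _ => O) ↔ toConf r O id x = 0 := by
  constructor
  · suffices arnoldIdeal r G (fun _ => O) ≤ TwoSidedIdeal.ker (toConf r O id) from
      fun hx => (TwoSidedIdeal.mem_ker _).1 (this hx)
    refine TwoSidedIdeal.span_le.2 ?_
    rintro _ ⟨w, hw, rfl⟩
    obtain ⟨-, a, hwalk⟩ := isCircuit_iff.1 hw
    rw [SetLike.mem_coe, TwoSidedIdeal.mem_ker, arnoldClass_eq_arnoldSum]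
    exact toConf_arnoldSum_eq_zero hwalk fun s _ => s.isLink.ne
  · intro h
    obtain ⟨S, hS, hx⟩ := exists_finite_mem_genSubring x
    exact mem_arnoldIdeal_of_mem_circuitIdeal _ (mem_circuitIdeal_of_toConf_eq_zero hS hx h)

theorem toConf_lambdaMap {H : Graph α β} (h : H ≤ G) (O : Orientation G) (φ : α → γ)
    (x : Lambda r E(H)) :
    toConf r O φ (lambdaMap r (Set.inclusion h.edgeSet_mono) x) = toConf r (O.restrict h) φ x := by
  have hcomp : (toConf r O φ).comp (lambdaMap r (Set.inclusion h.edgeSet_mono)) =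
      toConf r (O.restrict h) φ := lambda_hom_ext fun e => by simp [Orientation.restrict]
  exact RingHom.congr_fun hcomp x

end ToConf

end GraphRing

end

theorem mainTheorem4_general {α : Type*} {β : Type*} (r : ℕ) (Γ Γ' : Graph α β)
    (hloop : Γ.Loopless) (o : Odd r → GraphRing.Orientation Γ) (hsub : Γ' ≤ Γ) :
    Function.Injective (GraphRing.inclusionMap r o hsub) := by
  obtain ⟨O, rfl⟩ := GraphRing.exists_orientation_eq_const o
  refine (injective_iff_map_eq_zero _).2 fun y hy => ?_
  obtain ⟨x, rfl⟩ := RingCon.mk'_surjective _ y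
  have hx : GraphRing.lambdaMap r (Set.inclusion hsub.edgeSet_mono) x ∈
      GraphRing.arnoldIdeal r Γ fun _ => O :=
    (TwoSidedIdeal.mem_iff _ _).2 ((RingCon.eq _).1 hy)
  rw [GraphRing.mem_arnoldIdeal_iff hloop, GraphRing.toConf_lambdaMap hsub,
    ← GraphRing.mem_arnoldIdeal_iff (hloop.anti hsub)] at hx
  exact (RingCon.eq _).2 ((TwoSidedIdeal.mem_iff _ _).1 hx)

theorem mainTheorem4 {α : Type*} {β : Type*} (r : ℕ) (Γ Γ' : Graph α β) (hloop : Γ.Loopless)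
    (o : Odd r → GraphRing.Orientation Γ) (hsub : Γ' ≤ Γ) (hV : V(Γ') = V(Γ)) :
    Function.Injective (GraphRing.inclusionMap r o hsub) :=
  mainTheorem4_general r Γ Γ' hloop o hsub
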